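/- Let $E$ be a finite set. For a matroid $\mathsf M$ on $E$ let $\mathscr P(\mathsf M)=\operatorname{conv}\{e_B : B \text{ a basis of } \mathsf M\}\subseteq\mathbb R^E$, where $e_B=\sum_{i\in B}e_i$, be its base polytope, and let $\mathfrak M_E=\{\mathscr P(\mathsf M):\mathsf M\text{ a matroid on }E\}$; a matroid is identified with its base polytope. Let $\mathbb I_{\mathfrak M_E}$ be the group of all finite integer combinations of the indicator functions $\mathbb 1_{\mathscr P}:\mathbb R^E\to\mathbb Z$ of the polytopes $\mathscr P\in\mathfrak M_E$. A map $f:\mathfrak M_E\to A$ to an abelian group $A$ is called a (strong) valuation if there is a homomorphism of abelian groups $\widehat f:\mathbb I_{\mathfrak M_E}\to A$ with $f(\mathscr P)=\widehat f(\mathbb 1_{\mathscr P})$ for all $\mathscr P\in\mathfrak M_E$. Let $m\ge 0$ and let $F_0\subsetneq F_1\subsetneq\cdots\subsetneq F_m\subsetneq E$ be a fixed flag of subsets. Then the map $\widehat{\phi}_{F_0,\ldots,F_m}:\mathfrak M_E\to\mathbb Q$ with $$\widehat{\phi}_{F_0,\ldots,F_m}(\mathsf M)=\begin{cases}1&\text{if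 } F_i \text{ is a flat of } \mathsf M \text{ for all } 0\le i\le m,\\0&\text{otherwise}\end{cases}$$ is a valuation. Moreover, for every integer vector $(r_0,\ldots,r_m)$, the map $\phi:\mathfrak M_E\to\mathbb Q$ with $$\phi(\mathsf M)=\begin{cases}1&\text{if } F_i \text{ is a flat of } \mathsf M \text{ and } \operatorname{rk}_{\mathsf M}(F_i)=r_i \text{ for all } 0\le i\le m,\\0&\text{otherwise}\end{cases}$$ is a valuation. -/

import Mathlib

noncomputable section

namespace MatroidValuation

/-- The 0/1-vector `e_B = ∑_{i ∈ B} e_i` in `ℝ^E`. -/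
def vec {E : Type*} (B : Set E) : E → ℝ := B.indicator 1

/-- The matroids with ground set (all of) `E`. -/
abbrev MatroidOn (E : Type*) : Type _ := {M : Matroid E // M.E = Set.univ}

/-- The base polytope `𝒫(M)`: the convex hull of the vectors `e_B`, `B` a basis of `M`. -/
def basePolytope {E : Type*} (M : Matroid E) : Set (E → ℝ) :=
  convexHull ℝ (vec '' {B | M.IsBase B})

/-- The family `𝔐_E` of all base polytopes of matroids on `E`. -/
def matroidPolytopes (E : Type*) : Set (Set (E → ℝ)) :=
  Set.range fun M : MatroidOn E => basePolytope M.1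

/-- The indicator function `ℝ^E → ℤ` of a subset of `ℝ^E`. -/
def indicatorFun {E : Type*} (P : Set (E → ℝ)) : (E → ℝ) → ℤ := P.indicator 1

/-- The indicator subgroup `𝕀_𝔓` of a family `𝔓` of polytopes: the group of all
finite integer combinations of the indicator functions of the members of `𝔓`. -/
def indicatorSubgroup {E : Type*} (𝔓 : Set (Set (E → ℝ))) : AddSubgroup ((E → ℝ) → ℤ) :=
  AddSubgroup.closure (indicatorFun '' 𝔓)

/-- The map `𝔓 → 𝕀_𝔓` sending a polytope to its indicator function. -/
def toIndicator {E : Type*} (𝔓 : Set (Set (E → ℝ))) (P : 𝔓) : indicatorSubgroup 𝔓 :=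
  ⟨indicatorFun P.1, AddSubgroup.subset_closure ⟨P.1, P.2, rfl⟩⟩

/-- A (strong) valuation on a family `𝔓` of polytopes: a map into an abelian group that
factors through the indicator map by a homomorphism of abelian groups `𝕀_𝔓 → A`. -/
def IsValuation {E : Type*} {A : Type*} [AddCommGroup A] (𝔓 : Set (Set (E → ℝ)))
    (f : 𝔓 → A) : Prop :=
  ∃ g : indicatorSubgroup 𝔓 →+ A, ∀ P : 𝔓, f P = g (toIndicator 𝔓 P)

/-- A set is a basis exactly if its 0/1-vector lies in the base polytope. -/
theorem vec_mem_basePolytope_iff {E : Type*} [Finite E] (M : Matroid E) (B : Set E) :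
    vec B ∈ basePolytope M ↔ M.IsBase B := by
  classical
  have := Fintype.ofFinite E
  refine ⟨fun h => ?_, fun h => subset_convexHull ℝ _ ⟨B, h, rfl⟩⟩
  by_contra hB
  -- the linear functional whose strict maximum on the cube is attained at `vec B`
  let l : (E → ℝ) →ₗ[ℝ] ℝ := ∑ i, (if i ∈ B then (1 : ℝ) else -1) • LinearMap.proj i
  have hl : ∀ x, l x = ∑ i, (if i ∈ B then (1 : ℝ) else -1) * x i := fun x => by
    simp only [l, LinearMap.sum_apply, LinearMap.smul_apply, LinearMap.proj_apply, smul_eq_mul]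
  have hsub : vec '' {B' | M.IsBase B'} ⊆ {x | l x < l (vec B)} := by
    rintro _ ⟨B', hB', rfl⟩
    have hne : B' ≠ B := fun h => hB (h ▸ hB')
    change l (vec B') < l (vec B)
    rw [hl, hl]
    have hle : ∀ i, (if i ∈ B then (1 : ℝ) else -1) * vec B' i ≤
        (if i ∈ B then (1 : ℝ) else -1) * vec B i := by
      intro i
      by_cases h1 : i ∈ B <;> by_cases h2 : i ∈ B' <;> simp [vec, h1, h2]
    obtain ⟨i, hi⟩ : ∃ i, ¬ (i ∈ B' ↔ i ∈ B) := by
      by_contra hcon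
      push Not at hcon
      exact hne (Set.ext hcon)
    refine Finset.sum_lt_sum (fun i _ => hle i) ⟨i, Finset.mem_univ i, ?_⟩
    by_cases h1 : i ∈ B <;> by_cases h2 : i ∈ B' <;> simp_all [vec]
  have hconv : Convex ℝ {x | l x < l (vec B)} := convex_halfSpace_lt l.isLinear _
  have hlt : l (vec B) < l (vec B) := convexHull_min hsub hconv h
  exact lt_irrefl _ hlt

theorem basePolytope_injective (E : Type*) [Finite E] :
    Function.Injective fun M : MatroidOn E => basePolytope M.1 := by
  intro M N h
  apply Subtype.ext
  apply Matroid.ext_isBase (M.2.trans N.2.symm)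
  intro B _
  have h' : basePolytope M.1 = basePolytope N.1 := h
  rw [← vec_mem_basePolytope_iff, ← vec_mem_basePolytope_iff, h']

/-- The identification of a matroid on the finite set `E` with its base polytope. -/
def polytopeEquiv (E : Type*) [Finite E] : MatroidOn E ≃ matroidPolytopes E :=
  Equiv.ofInjective _ (basePolytope_injective E)

/-- The rank of a set in a matroid, as a natural number (it is finite if `E` is finite). -/
def rk {E : Type*} (M : Matroid E) (X : Set E) : ℕ := (M.eRk X).toNat

open Classical in
/-- The map `𝔐_E → ℚ` with value `1` if all `F_i` are flats of the matroid, else `0`. -/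
def flagFlats {E : Type*} [Finite E] {m : ℕ} (F : Fin (m + 1) → Set E)
    (P : matroidPolytopes E) : ℚ :=
  if ∀ i, ((polytopeEquiv E).symm P).1.IsFlat (F i) then 1 else 0

open Classical in
/-- The map `𝔐_E → ℚ` with value `1` if all `F_i` are flats of the matroid and
`rk F_i = r_i` for all `i`, else `0`. -/
def flagFlatsRank {E : Type*} [Finite E] {m : ℕ} (F : Fin (m + 1) → Set E)
    (r : Fin (m + 1) → ℤ) (P : matroidPolytopes E) : ℚ :=
  if ∀ i, ((polytopeEquiv E).symm P).1.IsFlat (F i) ∧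
      (rk ((polytopeEquiv E).symm P).1 (F i) : ℤ) = r i then 1 else 0

end MatroidValuation

end

/-! For a closed convex set `H`, the map that is 1 on polytopes meeting `H` and 0 on the others is a
valuation: it is the Euler characteristic of `P ∩ H`. If the sets `X k` form a chain, one basis
attains all their ranks at once, so a base polytope meets `⋂ k, {x | q k ≤ x(X k)}` exactly if `q k
≤ rk (X k)` for all `k`. Such joint rank bounds are therefore valuative.

It remains to write the flag conditions through such bounds. Put `N i = ⋂ j > i, F j`. All `F i` are
flats iff `cl (F i) ∩ N i ⊆ F i` for every `i`. Inclusion-exclusion over `T ⊆ N i \ F i` turns this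
into conditions `T ⊆ cl (F i)`, and each of these, with the rank of `F i` fixed, is a difference of
two rank bounds on `F i` and `F i ∪ T`. Multiplying over `i`, every term only involves the sets `F i
⊆ F i ∪ T i ⊆ F (i+1)`, which form a chain. Summing over rank vectors removes the rank condition. -/

open Filter Topology

namespace MatroidValuation

/-! ### Euler characteristic of compact convex sets -/

section EulerCharacteristic

-- Just to the right of `t`, the indicator of a compact interval drops by 1 exactly if `t` is its
-- right endpoint. Hence the coefficients of the intervals with a given right endpoint sum to zero.
open Classical in
theorem sum_nonempty_eq_zero_of_real {ι : Type*} (s : Finset ι) (a : ι → ℤ) (J : ι → Set ℝ)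
    (hc : ∀ i, IsCompact (J i)) (hv : ∀ i, Convex ℝ (J i))
    (h : ∀ t, ∑ i ∈ s, (if t ∈ J i then a i else 0) = 0) :
    ∑ i ∈ s, (if (J i).Nonempty then a i else 0) = 0 := by
  have jump : ∀ t i, ∀ᶠ x in 𝓝[>] t, (if (J i).Nonempty ∧ sSup (J i) = t then a i else 0) =
      (if t ∈ J i then a i else 0) - (if x ∈ J i then a i else 0) := by
    intro t i
    by_cases ht : t ∈ J i
    · have hne : (J i).Nonempty := ⟨t, ht⟩
      rcases (le_csSup (hc i).bddAbove ht).eq_or_lt with h1 | h1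
      · filter_upwards [self_mem_nhdsWithin] with x hx
        have hx' : x ∉ J i := fun hxJ =>
          absurd (le_csSup (hc i).bddAbove hxJ) (by rw [← h1]; exact not_le.2 hx)
        simp [hne, ← h1, ht, hx']
      · filter_upwards [Ioo_mem_nhdsGT h1] with x hx
        have hx' : x ∈ J i :=
          (hv i).ordConnected.out ht ((hc i).sSup_mem hne) ⟨hx.1.le, hx.2.le⟩
        simp [h1.ne', ht, hx']
    · have hx : ∀ᶠ x in 𝓝[>] t, x ∉ J i :=
        nhdsWithin_le_nhds ((hc i).isClosed.isOpen_compl.mem_nhds ht)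
      filter_upwards [hx] with x hx
      have : ¬ ((J i).Nonempty ∧ sSup (J i) = t) := fun hn =>
        ht (hn.2 ▸ (hc i).sSup_mem hn.1)
      simp [ht, hx, this]
  have fiber : ∀ t, ∑ i ∈ s, (if (J i).Nonempty ∧ sSup (J i) = t then a i else 0) = 0 := by
    intro t
    obtain ⟨x, hx⟩ := ((eventually_all_finset s).2 fun i _ => jump t i).exists
    rw [Finset.sum_congr rfl hx, Finset.sum_sub_distrib, h, h, sub_zero]
  rw [← Finset.sum_fiberwise_of_maps_to (t := s.image fun i => sSup (J i))
    (fun i hi => Finset.mem_image_of_mem _ hi)]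
  refine Finset.sum_eq_zero fun t _ => ?_
  rw [Finset.sum_filter]
  refine (Finset.sum_congr rfl fun i _ => ?_).trans (fiber t)
  by_cases h1 : (J i).Nonempty <;> by_cases h2 : sSup (J i) = t <;> simp [h1, h2]

open Classical in
/-- The Euler characteristic respects linear relations between indicator functions of compact
convex sets. -/
theorem sum_nonempty_eq_zero {E ι : Type*} [Finite E] (s : Finset ι) (a : ι → ℤ)
    (K : ι → Set (E → ℝ)) (hc : ∀ i, IsCompact (K i)) (hv : ∀ i, Convex ℝ (K i))
    (h : ∀ x, ∑ i ∈ s, (if x ∈ K i then a i else 0) = 0) :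
    ∑ i ∈ s, (if (K i).Nonempty then a i else 0) = 0 := by
  have := Fintype.ofFinite E
  -- The relation survives projecting out the coordinates in `S`. Removing one more coordinate `e₀`
  -- is the one-dimensional case, applied to the values of `x e₀` on a slice.
  have key : ∀ (S : Finset E) (y : E → ℝ),
      ∑ i ∈ s, (if ∃ x ∈ K i, ∀ e ∉ S, x e = y e then a i else 0) = 0 := by
    intro S
    induction S using Finset.induction_on with
    | empty =>
      intro y
      refine (Finset.sum_congr rfl fun i _ => ?_).trans (h y)
      have : (∃ x ∈ K i, ∀ e ∉ (∅ : Finset E), x e = y e) ↔ y ∈ K i :=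
        ⟨fun ⟨x, hx, hxy⟩ => (funext fun e => hxy e (by simp) : x = y) ▸ hx,
          fun hy => ⟨y, hy, fun _ _ => rfl⟩⟩
      simp only [this]
    | insert e₀ S he ih =>
      intro y
      let L : Set (E → ℝ) := {x | ∀ e ∉ insert e₀ S, x e = y e}
      have hL : IsClosed L := by
        simp only [L, Set.ofPred_forall]
        exact isClosed_iInter fun e => isClosed_iInter fun _ =>
          isClosed_eq (continuous_apply e) continuous_const
      have hLv : Convex ℝ L := by
        intro x hx z hz p q _ _ hpq e he
        simp only [Pi.add_apply, Pi.smul_apply, hx e he, hz e he, ← add_smul, hpq, one_smul]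
      have := sum_nonempty_eq_zero_of_real s a (fun i => (fun x : E → ℝ => x e₀) '' (K i ∩ L))
        (fun i => ((hc i).inter_right hL).image (continuous_apply e₀))
        (fun i => ((hv i).inter hLv).linear_image (LinearMap.proj e₀)) (fun t => by
          refine (Finset.sum_congr rfl fun i _ => ?_).trans (ih (Function.update y e₀ t))
          have : t ∈ (fun x : E → ℝ => x e₀) '' (K i ∩ L) ↔
              ∃ x ∈ K i, ∀ e ∉ S, x e = Function.update y e₀ t e := by
            constructor
            · rintro ⟨x, ⟨hx, hxL⟩, rfl⟩
              refine ⟨x, hx, fun e heS => ?_⟩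
              by_cases hee : e = e₀
              · subst hee; simp
              · rw [Function.update_of_ne hee]; exact hxL e (by simp [hee, heS])
            · rintro ⟨x, hx, hxy⟩
              refine ⟨x, ⟨hx, fun e heS => ?_⟩, by simpa using hxy e₀ he⟩
              simp only [Finset.mem_insert, not_or] at heS
              rw [hxy e heS.2, Function.update_of_ne heS.1]
          simp only [this])
      refine (Finset.sum_congr rfl fun i _ => ?_).trans this
      simp only [Set.image_nonempty]
      rfl
  refine (Finset.sum_congr rfl fun i _ => ?_).trans (key Finset.univ 0)
  have : (∃ x ∈ K i, ∀ e ∉ Finset.univ, x e = (0 : E → ℝ) e) ↔ (K i).Nonempty := by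
    simp [Set.Nonempty]
  simp only [this]

end EulerCharacteristic

/-! ### Valuations and linear relations -/

section Valuations

variable {E : Type*} {𝔓 : Set (Set (E → ℝ))}

theorem IsValuation.zero {A : Type*} [AddCommGroup A] : IsValuation 𝔓 (fun _ => (0 : A)) :=
  ⟨0, fun _ => rfl⟩

theorem IsValuation.add {A : Type*} [AddCommGroup A] {f₁ f₂ : 𝔓 → A} (h₁ : IsValuation 𝔓 f₁)
    (h₂ : IsValuation 𝔓 f₂) : IsValuation 𝔓 (fun P => f₁ P + f₂ P) := by
  obtain ⟨g₁, hg₁⟩ := h₁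
  obtain ⟨g₂, hg₂⟩ := h₂
  exact ⟨g₁ + g₂, fun P => congrArg₂ (· + ·) (hg₁ P) (hg₂ P)⟩

theorem IsValuation.sum {A κ : Type*} [AddCommGroup A] (s : Finset κ) (f : κ → 𝔓 → A)
    (h : ∀ k ∈ s, IsValuation 𝔓 (f k)) : IsValuation 𝔓 (fun P => ∑ k ∈ s, f k P) := by
  classical
  induction s using Finset.induction_on with
  | empty => simpa using IsValuation.zero
  | insert k s hk ih =>
    simp only [Finset.sum_insert hk]
    exact (h k (by simp)).add (ih fun j hj => h j (by simp [hj]))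

theorem IsValuation.const_mul {f : 𝔓 → ℚ} (c : ℚ) (h : IsValuation 𝔓 f) :
    IsValuation 𝔓 (fun P => c * f P) := by
  obtain ⟨g, hg⟩ := h
  exact ⟨(AddMonoidHom.mulLeft c).comp g, fun P => congrArg (c * ·) (hg P)⟩

/-- A map is a valuation if it respects all linear relations between indicator functions. -/
theorem IsValuation.of_relations {A : Type*} [AddCommGroup A] (f : 𝔓 → A)
    (h : ∀ c : 𝔓 →₀ ℤ, (∀ x, c.sum (fun P n => n * indicatorFun P.1 x) = 0) →
      c.sum (fun P n => n • f P) = 0) : IsValuation 𝔓 f := by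
  let Φ : (𝔓 →₀ ℤ) →ₗ[ℤ] indicatorSubgroup 𝔓 := Finsupp.linearCombination ℤ (toIndicator 𝔓)
  let Ψ : (𝔓 →₀ ℤ) →ₗ[ℤ] A := Finsupp.linearCombination ℤ f
  have hval : ∀ c, ((Φ c : indicatorSubgroup 𝔓) : (E → ℝ) → ℤ) =
      fun x => c.sum fun P n => n * indicatorFun P.1 x := by
    intro c
    funext x
    simp only [Φ, Finsupp.linearCombination_apply, Finsupp.sum, AddSubgroup.val_finsetSum,
      Finset.sum_apply, AddSubgroup.coe_zsmul, Pi.smul_apply, smul_eq_mul]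
    rfl
  have hsurj : Function.Surjective Φ.toAddMonoidHom := by
    rintro ⟨y, hy⟩
    induction hy using AddSubgroup.closure_induction with
    | mem y hy =>
      obtain ⟨P, hP, rfl⟩ := hy
      exact ⟨Finsupp.single ⟨P, hP⟩ 1, by simp [Φ]; rfl⟩
    | zero => exact ⟨0, by simp; rfl⟩
    | add x y _ _ hx hy =>
      obtain ⟨c, hc⟩ := hx
      obtain ⟨d, hd⟩ := hy
      exact ⟨c + d, by rw [map_add, hc, hd]; rfl⟩
    | neg x _ hx =>
      obtain ⟨c, hc⟩ := hx
      exact ⟨-c, by rw [map_neg, hc]; rfl⟩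
  have hker : Φ.toAddMonoidHom.ker ≤ Ψ.toAddMonoidHom.ker := by
    intro c hc
    have hc' : Φ c = 0 := hc
    change Ψ c = 0
    rw [Finsupp.linearCombination_apply]
    refine h c fun x => ?_
    have := congrFun (hval c) x
    rw [hc'] at this
    exact this.symm
  refine ⟨Φ.toAddMonoidHom.liftOfSurjective hsurj ⟨Ψ.toAddMonoidHom, hker⟩, fun P => ?_⟩
  have h1 : toIndicator 𝔓 P = Φ.toAddMonoidHom (Finsupp.single P 1) := by simp [Φ]
  rw [h1, AddMonoidHom.liftOfRightInverse_comp_apply]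
  simp [Ψ]

open Classical in
theorem isValuation_inter_nonempty [Finite E] (hc : ∀ P ∈ 𝔓, IsCompact P)
    (hv : ∀ P ∈ 𝔓, Convex ℝ P) {H : Set (E → ℝ)} (hH : IsClosed H) (hHv : Convex ℝ H) :
    IsValuation 𝔓 (fun P => if (P.1 ∩ H).Nonempty then (1 : ℚ) else 0) := by
  refine IsValuation.of_relations _ fun c hrel => ?_
  have := sum_nonempty_eq_zero c.support c (fun P => P.1 ∩ H)
    (fun P => (hc P.1 P.2).inter_right hH) (fun P => (hv P.1 P.2).inter hHv) (fun x => by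
      by_cases hx : x ∈ H
      · refine (Finset.sum_congr rfl fun P _ => ?_).trans (hrel x)
        by_cases hP : x ∈ P.1 <;> simp [indicatorFun, hP, hx]
      · simp [hx])
  have h2 := congrArg (Int.cast : ℤ → ℚ) this
  rw [Int.cast_zero, Int.cast_sum] at h2
  refine (Finset.sum_congr rfl fun P _ => ?_).trans h2
  by_cases hP : (P.1 ∩ H).Nonempty <;> simp [hP]

end Valuations

/-! ### Ranks along a chain -/

section Rank

variable {E : Type*} [Finite E]

theorem cast_rk (M : Matroid E) (X : Set E) : (rk M X : ℕ∞) = M.eRk X :=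
  ENat.natCast_toNat ((M.eRk_le_encard X).trans_lt X.toFinite.encard_lt_top).ne

theorem rk_mono (M : Matroid E) {X Y : Set E} (h : X ⊆ Y) : rk M X ≤ rk M Y := by
  have := M.eRk_mono h
  rw [← cast_rk, ← cast_rk] at this
  exact_mod_cast this

theorem rk_le_card (M : Matroid E) (X : Set E) : rk M X ≤ Nat.card E := by
  have := M.eRk_le_encard X
  rw [← cast_rk, ← X.toFinite.cast_ncard_eq] at this
  exact (show rk M X ≤ X.ncard by exact_mod_cast this).trans (Set.ncard_le_card X)

theorem ncard_inter_le_rk {M : Matroid E} {B : Set E} (hB : M.IsBase B) (X : Set E) :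
    (B ∩ X).ncard ≤ rk M X := by
  have := (hB.indep.inter_right X).encard_le_eRk_of_subset Set.inter_subset_right
  rw [← cast_rk, ← (B ∩ X).toFinite.cast_ncard_eq] at this
  exact_mod_cast this

theorem rk_union_le_iff {M : Matroid E} (hM : M.E = Set.univ) (X T : Set E) :
    rk M (X ∪ T) ≤ rk M X ↔ T ⊆ M.closure X := by
  constructor
  · intro h
    have h1 : M.eRk (X ∪ T) ≤ M.eRk X := by
      rw [← cast_rk, ← cast_rk]; exact_mod_cast h
    have h2 := (M.isRkFinite_set X).closure_eq_closure_of_subset_of_eRk_ge_eRk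
      Set.subset_union_left h1
    rw [h2]
    exact (Set.subset_union_right).trans (M.subset_closure _ (by simp [hM]))
  · intro h
    have h1 : M.eRk (X ∪ T) ≤ M.eRk (M.closure X) :=
      M.eRk_mono (Set.union_subset (M.subset_closure X (by simp [hM])) h)
    rw [Matroid.eRk_closure_eq, ← cast_rk, ← cast_rk] at h1
    exact_mod_cast h1

/-- Some basis of a matroid meets every member of a given chain in a basis of that member. -/
theorem exists_isBase_forall_isBasis_of_isChain {M : Matroid E} (hM : M.E = Set.univ)
    (𝒞 : Finset (Set E)) (h𝒞 : IsChain (· ⊆ ·) (𝒞 : Set (Set E))) :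
    ∃ B, M.IsBase B ∧ ∀ X ∈ 𝒞, (B ∩ X).ncard = rk M X := by
  classical
  have hsub : ∀ X : Set E, X ⊆ M.E := fun X => by simp [hM]
  have grow : ∀ {I J X : Set E}, M.IsBasis (I ∩ X) X → I ⊆ J → M.Indep J →
      M.IsBasis (J ∩ X) X := fun {I J X} hI hIJ hJ => by
    rwa [← hI.eq_of_subset_indep (hJ.inter_right X) (Set.inter_subset_inter_left X hIJ)
      Set.inter_subset_right]
  -- Keeping `I` inside a member of the chain (or empty) lets it be extended within the next, larger
  -- member.
  have key : ∃ I, M.Indep I ∧ (∃ X, I ⊆ X ∧ (X ∈ 𝒞 ∨ X = ∅)) ∧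
      ∀ X ∈ 𝒞, M.IsBasis (I ∩ X) X := by
    induction 𝒞 using Finset.induction_on_max_value (Set.ncard (α := E)) with
    | empty => exact ⟨∅, M.empty_indep, ⟨∅, by simp⟩, by simp⟩
    | insert X 𝒟 hX hmax ih =>
      have htop : ∀ Y ∈ 𝒟, Y ⊆ X := by
        intro Y hY
        rcases h𝒞.total (x := Y) (y := X) (by simp [hY]) (by simp) with h | h
        · exact h
        · exact (Set.eq_of_subset_of_ncard_le h (hmax Y hY)).ge
      obtain ⟨I, hI, ⟨Z, hIZ, hZ⟩, hb⟩ := ih (h𝒞.mono (by simp))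
      have hIX : I ⊆ X := hIZ.trans (hZ.elim (htop Z) fun h => h ▸ Set.empty_subset X)
      obtain ⟨J, hJ, hIJ⟩ := hI.subset_isBasis_of_subset hIX (hsub X)
      refine ⟨J, hJ.indep, ⟨X, hJ.subset, by simp⟩, fun Y hY => ?_⟩
      rcases Finset.mem_insert.1 hY with rfl | hY
      · rwa [Set.inter_eq_self_of_subset_left hJ.subset]
      · exact grow (hb Y hY) hIJ hJ.indep
  obtain ⟨I, hI, -, hb⟩ := key
  obtain ⟨B, hB, hIB⟩ := hI.exists_isBase_superset
  refine ⟨B, hB, fun X hX => ?_⟩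
  have := (grow (hb X hX) hIB hB.indep).encard_eq_eRk
  rw [← cast_rk, ← (B ∩ X).toFinite.cast_ncard_eq] at this
  exact_mod_cast this

end Rank

/-! ### Rank bounds as intersections with half-spaces -/

section BasePolytope

variable {E : Type*} [Finite E]

/-- The sum of the coordinates indexed by the elements of `X`. -/
noncomputable def coordSum (X : Set E) : (E → ℝ) →ₗ[ℝ] ℝ := ∑ᶠ i ∈ X, LinearMap.proj i

theorem coordSum_apply (X : Set E) (x : E → ℝ) : coordSum X x = ∑ᶠ i ∈ X, x i := by
  rw [coordSum, finsum_mem_eq_finite_toFinset_sum _ X.toFinite,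
    finsum_mem_eq_finite_toFinset_sum _ X.toFinite, LinearMap.sum_apply]
  rfl

theorem coordSum_vec (X B : Set E) : coordSum X (vec B) = ((B ∩ X).ncard : ℝ) := by
  classical
  rw [coordSum_apply, finsum_mem_eq_finite_toFinset_sum _ X.toFinite,
    Set.ncard_eq_toFinset_card _ (B ∩ X).toFinite]
  simp only [vec, Set.indicator_apply, Pi.one_apply, Finset.sum_boole]
  congr 2
  ext i
  simp [and_comm]

theorem continuous_coordSum (X : Set E) : Continuous (coordSum X) :=
  LinearMap.continuous_of_finiteDimensional _

theorem coordSum_le_rk {M : Matroid E} {x : E → ℝ} (hx : x ∈ basePolytope M) (X : Set E) :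
    coordSum X x ≤ rk M X := by
  refine convexHull_min (s := vec '' {B | M.IsBase B}) (t := {x | coordSum X x ≤ rk M X}) ?_
    (convex_halfSpace_le (coordSum X).isLinear _) hx
  rintro _ ⟨B, hB, rfl⟩
  change coordSum X (vec B) ≤ rk M X
  rw [coordSum_vec]
  exact_mod_cast ncard_inter_le_rk hB X

theorem isCompact_basePolytope (M : Matroid E) : IsCompact (basePolytope M) :=
  (Set.toFinite _).isCompact_convexHull ℝ

theorem basePolytope_polytopeEquiv_symm (P : matroidPolytopes E) :
    basePolytope ((polytopeEquiv E).symm P).1 = P.1 :=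
  congrArg Subtype.val ((polytopeEquiv E).apply_symm_apply P)

open Classical in
/-- For sets in a chain, the condition that their ranks are bounded below is valuative. -/
theorem isValuation_rk_ge {κ : Type*} [Finite κ] (X : κ → Set E)
    (hX : IsChain (· ⊆ ·) (Set.range X)) (q : κ → ℤ) :
    IsValuation (matroidPolytopes E) (fun P =>
      if ∀ k, q k ≤ rk ((polytopeEquiv E).symm P).1 (X k) then (1 : ℚ) else 0) := by
  let H : Set (E → ℝ) := ⋂ k, {x | (q k : ℝ) ≤ coordSum (X k) x}
  have hH : IsClosed H :=
    isClosed_iInter fun k => isClosed_le continuous_const (continuous_coordSum _)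
  have hHv : Convex ℝ H := convex_iInter fun k => convex_halfSpace_ge (coordSum (X k)).isLinear _
  have := isValuation_inter_nonempty (𝔓 := matroidPolytopes E)
    (by rintro _ ⟨M, rfl⟩; exact isCompact_basePolytope M.1)
    (by rintro _ ⟨M, rfl⟩; exact convex_convexHull ℝ _) hH hHv
  convert this using 4 with P
  rw [← basePolytope_polytopeEquiv_symm]
  set M := (polytopeEquiv E).symm P
  constructor
  · intro h
    obtain ⟨B, hB, hBX⟩ := exists_isBase_forall_isBasis_of_isChain M.2
      (Set.finite_range X).toFinset (by simpa using hX)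
    refine ⟨vec B, subset_convexHull ℝ _ ⟨B, hB, rfl⟩, Set.mem_iInter.2 fun k => ?_⟩
    change (q k : ℝ) ≤ coordSum (X k) (vec B)
    rw [coordSum_vec, hBX (X k) (by simp)]
    exact_mod_cast h k
  · rintro ⟨x, hx, hxH⟩ k
    have := (Set.mem_iInter.1 hxH k).trans (coordSum_le_rk hx (X k))
    exact_mod_cast this

end BasePolytope

/-! ### Flags of flats -/

section Flats

variable {E : Type*}

/-- Descending induction: once every `F j` with `j > i` is a flat, `cl (F i)` lies in their
intersection, so testing inside it loses nothing. -/
theorem forall_isFlat_iff {ι : Type*} [LinearOrder ι] [Finite ι] {M : Matroid E}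
    (hM : M.E = Set.univ) {F : ι → Set E} (hF : StrictMono F) :
    (∀ i, M.IsFlat (F i)) ↔ ∀ i, M.closure (F i) ∩ (⋂ j > i, F j) ⊆ F i := by
  constructor
  · intro h i
    rw [(h i).closure]
    exact Set.inter_subset_left
  · intro h i
    induction i using WellFoundedGT.induction with
    | ind i ih =>
      have hsub : M.closure (F i) ⊆ ⋂ j > i, F j := Set.subset_iInter₂ fun j hj => by
        rw [← (ih j hj).closure]
        exact M.closure_subset_closure (hF hj).le
      rw [Matroid.isFlat_iff_closure_eq]
      exact ((Set.subset_inter subset_rfl hsub).trans (h i)).antisymm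
        (M.subset_closure _ (by simp [hM]))

theorem isChain_range_sumElim {ι : Type*} [LinearOrder ι] {F G : ι → Set E} (hF : StrictMono F)
    (hFG : ∀ i, F i ⊆ G i) (hG : ∀ i j, i < j → G i ⊆ F j) :
    IsChain (· ⊆ ·) (Set.range (Sum.elim F G)) := by
  rintro _ ⟨i | i, rfl⟩ _ ⟨j | j, rfl⟩ -
  · exact (le_total i j).imp (fun h => hF.monotone h) fun h => hF.monotone h
  · exact (le_or_gt i j).imp (fun h => (hF.monotone h).trans (hFG j)) fun h => hG j i h
  · exact (lt_or_ge i j).imp (fun h => hG i j h) fun h => (hF.monotone h).trans (hFG i)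
  · rcases lt_trichotomy i j with h | rfl | h
    · exact Or.inl ((hG i j h).trans (hFG j))
    · exact Or.inl subset_rfl
    · exact Or.inr ((hG j i h).trans (hFG i))

variable [Finite E]

open Classical in
/-- Möbius inversion expressing flatness of `X` relative to `N`, together with the rank of `X`,
by lower bounds for ranks. -/
theorem ite_closure_inter_subset_eq_sum {M : Matroid E} (hM : M.E = Set.univ) (X N : Set E)
    (r : ℤ) :
    (if M.closure X ∩ N ⊆ X ∧ (rk M X : ℤ) = r then (1 : ℚ) else 0) =
      ∑ p ∈ (N \ X).toFinite.toFinset.powerset ×ˢ Finset.range 2,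
        (-1) ^ (p.1.card + p.2) *
          (if r ≤ rk M X ∧ r + p.2 ≤ rk M (X ∪ p.1) then (1 : ℚ) else 0) := by
  rw [Finset.sum_product]
  simp only [Finset.sum_range_succ, Finset.range_zero, Finset.sum_empty, zero_add, add_zero,
    Nat.cast_zero, Nat.cast_one]
  -- The thresholds `r` and `r + 1` isolate `rk (X ∪ T) = r`; with `r ≤ rk X` and monotonicity both
  -- ranks equal `r`, that is, `T ⊆ cl X`.
  have hterm : ∀ T : Finset E, (-1 : ℚ) ^ T.card *
        (if r ≤ rk M X ∧ r ≤ rk M (X ∪ T) then (1 : ℚ) else 0) +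
      (-1) ^ (T.card + 1) * (if r ≤ rk M X ∧ r + 1 ≤ rk M (X ∪ T) then (1 : ℚ) else 0) =
      if (T : Set E) ⊆ M.closure X ∧ (rk M X : ℤ) = r then (-1) ^ T.card else 0 := by
    intro T
    have hmono : rk M X ≤ rk M (X ∪ T) := rk_mono M Set.subset_union_left
    have hiff := rk_union_le_iff hM X T
    rw [← hiff]
    by_cases h1 : r ≤ rk M X
    · have h2 : r ≤ rk M (X ∪ T) := by omega
      by_cases h3 : r + 1 ≤ rk M (X ∪ T)
      · rw [if_pos ⟨h1, h2⟩, if_pos ⟨h1, h3⟩, if_neg (by omega)]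
        ring
      · rw [if_pos ⟨h1, h2⟩, if_neg (by tauto), if_pos (by omega)]
        ring
    · rw [if_neg (by tauto), if_neg (by tauto), if_neg (by omega)]
      ring
  rw [Finset.sum_congr rfl fun T _ => hterm T]
  by_cases hr : (rk M X : ℤ) = r
  · simp only [hr, and_true]
    rw [← Finset.sum_filter]
    have hfil : (N \ X).toFinite.toFinset.powerset.filter
        (fun T : Finset E => (T : Set E) ⊆ M.closure X) =
        ((M.closure X ∩ N) \ X).toFinite.toFinset.powerset := by
      ext T
      simp only [Finset.mem_filter, Finset.mem_powerset, Set.Finite.subset_toFinset,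
        Set.subset_sdiff, Set.subset_inter_iff]
      tauto
    -- The alternating sum over all subsets of a finite set is 1 if that set is empty and 0
    -- otherwise.
    rw [hfil]
    have := congrArg (Int.cast : ℤ → ℚ)
      (Finset.sum_powerset_neg_one_pow_card (x := ((M.closure X ∩ N) \ X).toFinite.toFinset))
    push_cast at this
    rw [this]
    simp only [Set.Finite.toFinset_eq_empty, Set.sdiff_eq_empty]
  · simp [hr]

theorem isValuation_flagFlatsRank {m : ℕ} {F : Fin (m + 1) → Set E} (hF : StrictMono F)
    (r : Fin (m + 1) → ℤ) : IsValuation (matroidPolytopes E) (flagFlatsRank F r) := by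
  classical
  let N : Fin (m + 1) → Set E := fun i => ⋂ j > i, F j
  let A : Fin (m + 1) → Finset (Finset E × ℕ) := fun i =>
    (N i \ F i).toFinite.toFinset.powerset ×ˢ Finset.range 2
  have hexp : flagFlatsRank F r = fun P => ∑ p ∈ Fintype.piFinset A,
      (∏ i, (-1 : ℚ) ^ ((p i).1.card + (p i).2)) *
        (if ∀ k, Sum.elim r (fun i => r i + (p i).2) k ≤ rk ((polytopeEquiv E).symm P).1
          (Sum.elim F (fun i => F i ∪ (p i).1) k) then (1 : ℚ) else 0) := by
    funext P
    set M := (polytopeEquiv E).symm P with hMdef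
    have h1 : flagFlatsRank F r P =
        ∏ i, if M.1.closure (F i) ∩ N i ⊆ F i ∧ (rk M.1 (F i) : ℤ) = r i then (1 : ℚ) else 0 := by
      rw [Finset.prod_boole, flagFlatsRank]
      simp only [Finset.mem_univ, true_imp_iff, forall_and, ← hMdef, forall_isFlat_iff M.2 hF, N]
    rw [h1, Finset.prod_congr rfl fun i _ =>
      ite_closure_inter_subset_eq_sum M.2 (F i) (N i) (r i), Finset.prod_univ_sum]
    refine Finset.sum_congr rfl fun p _ => ?_
    rw [Finset.prod_mul_distrib, Finset.prod_boole]
    simp only [Finset.mem_univ, true_imp_iff, Sum.forall, Sum.elim_inl, Sum.elim_inr, forall_and]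
  rw [hexp]
  refine IsValuation.sum _ _ fun p hp => IsValuation.const_mul _ ?_
  have hchain : IsChain (· ⊆ ·) (Set.range (Sum.elim F fun i => F i ∪ ((p i).1 : Set E))) := by
    refine isChain_range_sumElim hF (fun i => Set.subset_union_left) fun i j hij => ?_
    refine Set.union_subset (hF hij).le ?_
    have hp' := Fintype.mem_piFinset.1 hp i
    simp only [A, Finset.mem_product, Finset.mem_powerset, Set.Finite.subset_toFinset] at hp'
    exact (hp'.1.trans Set.sdiff_subset).trans (Set.iInter₂_subset j hij)
  convert isValuation_rk_ge _ hchain (Sum.elim r fun i => r i + (p i).2)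

/-- Only the actual rank vector of `F` can contribute, and its entries are at most `Nat.card E`. -/
theorem flagFlats_eq_sum {m : ℕ} (F : Fin (m + 1) → Set E) :
    flagFlats F = fun P => ∑ r ∈ Fintype.piFinset fun _ : Fin (m + 1) =>
      Finset.range (Nat.card E + 1), flagFlatsRank F (fun i => (r i : ℤ)) P := by
  classical
  funext P
  simp only [flagFlats, flagFlatsRank]
  set M := (polytopeEquiv E).symm P
  rw [Finset.sum_eq_single_of_mem (fun i => rk M.1 (F i))
    (by simp [Fintype.mem_piFinset, rk_le_card])]
  · simp
  · intro r _ hr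
    refine if_neg fun h => hr (funext fun i => ?_)
    exact_mod_cast (h i).2.symm

end Flats

end MatroidValuation

theorem theorem8p5 {E : Type*} [Finite E] (m : ℕ) (F : Fin (m + 1) → Set E)
    (hF : StrictMono F) (hE : F (Fin.last m) ⊂ Set.univ) :
    MatroidValuation.IsValuation (MatroidValuation.matroidPolytopes E)
        (MatroidValuation.flagFlats F) ∧
      ∀ r : Fin (m + 1) → ℤ,
        MatroidValuation.IsValuation (MatroidValuation.matroidPolytopes E)
          (MatroidValuation.flagFlatsRank F r) := by
  refine ⟨?_, fun r => MatroidValuation.isValuation_flagFlatsRank hF r⟩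
  rw [MatroidValuation.flagFlats_eq_sum]
  exact MatroidValuation.IsValuation.sum _ _ fun r _ =>
    MatroidValuation.isValuation_flagFlatsRank hF _
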